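/- Throughout, vocabularies, variable sets, index sets, domains and the node sets of forests are finite. A (Boolean) conjunctive query $Q$ over a relational vocabulary $\mathcal R=(R_1,\dots,R_m)$ is a set $\mathrm{atoms}(Q)$ of atoms $A=R_\ell(\mathrm{vars}(A))$, where $\mathrm{vars}(A):[\mathrm{arity}(R_\ell)]\to \mathrm{vars}(Q)$ (variables may repeat in an atom) and every variable of $Q$ occurs in some atom. For a database $\mathcal D$ with domain $D$, $\hom(Q,\mathcal D)$ is the set of maps $f:\mathrm{vars}(Q)\to D$ with $f\circ\mathrm{vars}(A)\in R_\ell^{D}$ for every atom $A$ of $Q$ with relation name $R_\ell$. Write $Q_1\preceq Q_2$ if $|\hom(Q_1,\mathcal D)|\le|\hom(Q_2,\mathcal D)|$ for every database $\mathcal D$. The Gaifman graph of $Q$ has vertex set $\mathrm{vars}(Q)$; two distinct variables are adjacent iff they occur in a common atom. A tree decomposition of $Q$ is a forest $T$ with bags $\chi(t)\subseteq\mathrm{vars}(Q)$, $t\in\mathrm{nodes}(T)$, such that for every variable $x$ the set $\{t: x\in\chi(t)\}$ is connected in $T$, and the variables of every atom are contained in some bag. $Q$ is chordal if it has a tree decomposition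 in which every bag induces a clique of the Gaifman graph. A junction tree of $Q$ is a tree decomposition in which every bag induces a maximal clique of the Gaifman graph; it is simple if $|\chi(t_1)\cap\chi(t_2)|\le1$ for every edge $(t_1,t_2)$ of $T$, and totally disconnected if $\chi(t_1)\cap\chi(t_2)=\emptyset$ for every edge $(t_1,t_2)$ of $T$. A $V$-relation is a set $P$ of tuples $f:V\to D$. A $\mathrm{vars}(Q_1)$-relation $P$ induces the database $\Pi_{Q_1}(P)$ with domain $D$ and relations $$R_\ell^{D}=\bigcup_{A\in\mathrm{atoms}(Q_1),\ \mathrm{rel}(A)=R_\ell}\{f\circ\mathrm{vars}(A): f\in P\};$$ $P$ is a witness (for $Q_1\not\preceq Q_2$) if $|P|>|\hom(Q_2,\Pi_{Q_1}(P))|$. A $V$-relation is a product relation if it has the form $\prod_{x\in V}S_x$ with sets $S_x\subseteq D$. For $\psi:W\to 2^{V}$ and $f\in D^V$, let $\psi\cdot f=(f|_{\psi(y)})_{y\in W}$, where $f|_{\psi(y)}$ is regarded as a single value in the domain $D^{\psi(y)}$ (the domains $D^s$, $s\subseteq V$, being put together in their disjoint union). A $W$-relation is a normal relation if it has the form $\{\psi\cdot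 f: f\in P\}$ for some set $V$, some product $V$-relation $P$ and some $\psi:W\to2^V$. **Theorem.** Let $Q_1,Q_2$ be Boolean conjunctive queries over the same vocabulary, and let $Q_2$ be chordal. (i) If $Q_2$ has a totally disconnected junction tree, then $Q_1\not\preceq Q_2$ if and only if there is a witness that is a product relation. (ii) If $Q_2$ has a simple junction tree, then $Q_1\not\preceq Q_2$ if and only if there is a witness that is a normal relation. -/

import Mathlib

namespace CQ

/-- A relational vocabulary `(R_1, …, R_m)` with the arity of each symbol. -/
structure Vocabulary where
  numRel : ℕ
  arity : Fin numRel → ℕ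

/-- A relational structure (database instance) over `σ`; its domain is a finite set. -/
structure Database (σ : Vocabulary) where
  Dom : Type
  finiteDom : Finite Dom
  rel : ∀ i : Fin σ.numRel, Set (Fin (σ.arity i) → Dom)

attribute [instance] Database.finiteDom

/-- An atom `R_i(x)`: a relation symbol together with a function that puts a variable at each
attribute position of the symbol. Variables may be repeated. -/
@[ext]
structure QAtom (σ : Vocabulary) (V : Type*) where
  rel : Fin σ.numRel
  vars : Fin (σ.arity rel) → V

/-- A Boolean conjunctive query with set of variables `V`: a set of atoms (hence without repeated
atoms, and finite as soon as `V` is), in which every variable occurs. -/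
structure Query (σ : Vocabulary) (V : Type*) where
  atoms : Set (QAtom σ V)
  occurs : ∀ x : V, ∃ A ∈ atoms, x ∈ Set.range A.vars

namespace Query

variable {σ : Vocabulary} {V V₁ V₂ : Type*}

/-- `hom(Q, 𝒟)`: the maps from the variables to the domain that send each atom to a tuple of the
database. -/
def hom (Q : Query σ V) (𝒟 : Database σ) : Set (V → 𝒟.Dom) :=
  {f | ∀ A ∈ Q.atoms, f ∘ A.vars ∈ 𝒟.rel A.rel}

/-- `Q₁ ⪯ Q₂`: containment of Boolean queries under bag-set semantics. -/
def Contained (Q₁ : Query σ V₁) (Q₂ : Query σ V₂) : Prop :=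
  ∀ 𝒟 : Database σ, (Q₁.hom 𝒟).ncard ≤ (Q₂.hom 𝒟).ncard

/-- The Gaifman graph: two distinct variables are adjacent iff they occur in a common atom. -/
def gaifman (Q : Query σ V) : SimpleGraph V where
  Adj x y := x ≠ y ∧ ∃ A ∈ Q.atoms, x ∈ Set.range A.vars ∧ y ∈ Set.range A.vars
  symm := ⟨fun _ _ h => ⟨h.1.symm, h.2.imp fun _ hA => ⟨hA.1, hA.2.2, hA.2.1⟩⟩⟩
  loopless := ⟨fun _ h => h.1 rfl⟩

/-- A tree decomposition `(T, χ)` of a query; `T` is a finite undirected forest. -/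
structure TreeDecomposition (Q : Query σ V) where
  Node : Type
  finiteNode : Finite Node
  T : SimpleGraph Node
  acyclic : T.IsAcyclic
  /-- the bags -/
  χ : Node → Set V
  /-- running intersection: the nodes whose bags contain `x` are connected in `T` -/
  running : ∀ x : V, (T.induce {t | x ∈ χ t}).Preconnected
  /-- coverage: each atom has all its variables in some bag -/
  coverage : ∀ A ∈ Q.atoms, ∃ t, Set.range A.vars ⊆ χ t

namespace TreeDecomposition

variable {Q : Query σ V}

/-- A junction tree: every bag induces a maximal clique of the Gaifman graph. -/
def IsJunctionTree (τ : Q.TreeDecomposition) : Prop :=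
  ∀ t, Maximal Q.gaifman.IsClique (τ.χ t)

/-- Adjacent bags share at most one variable. -/
def IsSimple (τ : Q.TreeDecomposition) : Prop :=
  ∀ s t, τ.T.Adj s t → (τ.χ s ∩ τ.χ t).encard ≤ 1

/-- Adjacent bags share no variable. -/
def IsTotallyDisconnected (τ : Q.TreeDecomposition) : Prop :=
  ∀ s t, τ.T.Adj s t → τ.χ s ∩ τ.χ t = ∅

end TreeDecomposition

/-- A query is chordal if it has a tree decomposition all of whose bags induce cliques of the
Gaifman graph. -/
def IsChordal (Q : Query σ V) : Prop :=
  ∃ τ : Q.TreeDecomposition, ∀ t, Q.gaifman.IsClique (τ.χ t)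

end Query

/-- The generalized projection `Π_φ(P) = {f ∘ φ : f ∈ P}`. -/
def generalizedProjection {Y V D : Type*} (φ : Y → V) (P : Set (V → D)) : Set (Y → D) :=
  (fun f => f ∘ φ) '' P

/-- The database `Π_Q(P)` induced by a relation `P` over the variables of `Q`: the relation
`R_ℓ` is the union of the projections of `P` on the atoms of `Q` with relation name `R_ℓ`. -/
def Query.induced {σ : Vocabulary} {V : Type*} (Q : Query σ V) {D : Type} [Finite D]
    (P : Set (V → D)) : Database σ where
  Dom := D
  finiteDom := inferInstance
  rel ℓ := ⋃ φ ∈ {φ : Fin (σ.arity ℓ) → V | (⟨ℓ, φ⟩ : QAtom σ V) ∈ Q.atoms},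
    generalizedProjection φ P

/-- `P` is a witness for `Q₁ ⋠ Q₂`: `|P| > |hom(Q₂, Π_{Q₁}(P))|`. -/
def IsWitness {σ : Vocabulary} {V₁ V₂ : Type*} (Q₁ : Query σ V₁) (Q₂ : Query σ V₂)
    {D : Type} [Finite D] (P : Set (V₁ → D)) : Prop :=
  P.ncard > (Q₂.hom (Q₁.induced P)).ncard

/-- `P = ∏_{x ∈ V} S_x` for unary relations `S_x`. -/
def IsProductRelation {V D : Type*} (P : Set (V → D)) : Prop :=
  ∃ S : V → Set D, P = Set.univ.pi S

/-- The tuple `ψ · f = (f(ψ(y)))_{y ∈ W}`. Its components belong to different domains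
`D^{ψ(y)}`, which are put together in the disjoint union of the sets `D^s`, `s ⊆ V`. -/
def dotTuple {W V D : Type*} (ψ : W → Set V) (f : V → D) : W → (Σ s : Set V, (s → D)) :=
  fun y => ⟨ψ y, fun x => f x⟩

/-- There is a witness for `Q₁ ⋠ Q₂` that is a product relation over a finite domain. -/
def HasProductWitness {σ : Vocabulary} {V₁ V₂ : Type*} (Q₁ : Query σ V₁) (Q₂ : Query σ V₂) :
    Prop :=
  ∃ (D : Type) (_ : Finite D) (P : Set (V₁ → D)), IsProductRelation P ∧ IsWitness Q₁ Q₂ P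

/-- There is a witness for `Q₁ ⋠ Q₂` that is a normal relation, that is, of the form
`{ψ · f : f ∈ P}` where `P` is a product `V`-relation over a finite domain `D`, for some finite
set `V`, and `ψ : vars(Q₁) → 2^V`. -/
def HasNormalWitness {σ : Vocabulary} {V₁ V₂ : Type*} (Q₁ : Query σ V₁) (Q₂ : Query σ V₂) :
    Prop :=
  ∃ (V D : Type) (_ : Finite V) (_ : Finite D) (ψ : V₁ → Set V) (P : Set (V → D)),
    IsProductRelation P ∧ IsWitness Q₁ Q₂ (dotTuple ψ '' P)

end CQ

/-! A witness `P` refutes containment on the database `Π_{Q₁}(P)`, because `P ⊆ hom(Q₁, Π_{Q₁}(P))`.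
The converse turns an arbitrary counterexample `𝒟` into a structured one by way of entropy.

Let `h` be the entropy of the uniform distribution on `hom(Q₁, 𝒟)`, so that `h(V₁) = log |hom(Q₁,
𝒟)|`. Enumerate the bags `B_i` of the junction tree so that each meets its predecessors in a
separator `S_i` inside an intersection of adjacent bags. For every homomorphism `φ : Q₂ → Q₁`,
gluing marginals along the bags gives `∑ (h(φ B_i) - h(φ S_i)) ≤ log |hom(Q₂, 𝒟)|`
(`sum_entropy_le_log_card`), which is less than `h(V₁)` by a gap independent of `φ`.

Below `h` lies a sum of maximum functions `X ↦ ∑_k max_{x ∈ X} a_k(x)` that agrees with `h` on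
singletons and on `V₁` (`exists_sum_sup_le`). If separators have at most one element, replacing `h`
by this sum preserves the strict inequalities. If they are empty, a modular function suffices
(`exists_modular_le`).

After scaling and rounding, the `a_k` become numbers of visible bits. The resulting bit relation is
normal, and it is a product in the modular case. Its size is at least 2 to the total; for each `φ`,
the homomorphisms from `Q₂` over `φ` number at most 2 to the left-hand side. The enlarged gap
absorbs the number of maps `φ` (`isWitness_bitRelation`). -/

namespace SimpleGraph

/-! ### Enumerating the bags of a forest -/

variable {N : Type*} {G : SimpleGraph N}

/-- Every nonempty proper part of `A` is joined by an edge to the rest of `A`. -/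
def EdgeConnectedOn (G : SimpleGraph N) (A : Set N) : Prop :=
  ∀ C ⊆ A, C.Nonempty → (A \ C).Nonempty → ∃ a ∈ C, ∃ b ∈ A \ C, G.Adj a b

theorem Preconnected.edgeConnectedOn {A : Set N} (h : (G.induce A).Preconnected) :
    G.EdgeConnectedOn A := by
  rintro C hC ⟨a, ha⟩ ⟨b, hb⟩
  obtain ⟨p⟩ := h ⟨a, hC ha⟩ ⟨b, hb.1⟩
  obtain ⟨d, -, h1, h2⟩ := p.exists_boundary_dart {x | (x : N) ∈ C} ha hb.2
  exact ⟨d.fst, h1, d.snd, ⟨d.snd.2, h2⟩, d.adj⟩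

/-- If the part contains the neighbour of `t`, move `t` into it: the cut edge then cannot start at
`t`. Otherwise no edge leads from the part to `t`. -/
theorem EdgeConnectedOn.diff_leaf {A : Set N} (h : G.EdgeConnectedOn A) {t : N}
    (ht : ∀ w ∈ A, ∀ w' ∈ A, G.Adj t w → G.Adj t w' → w = w') :
    G.EdgeConnectedOn (A \ {t}) := by
  rintro C hC ⟨c, hc⟩ ⟨d, hd⟩
  by_cases htA : t ∈ A
  swap
  · rw [Set.sdiff_singleton_eq_self htA] at *
    exact h C hC ⟨c, hc⟩ ⟨d, hd⟩
  by_cases hu : ∃ u ∈ C, G.Adj t u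
  · obtain ⟨u, huC, htu⟩ := hu
    obtain ⟨a, ha, b, hb, hab⟩ := h (insert t C)
      (Set.insert_subset htA (hC.trans Set.sdiff_subset)) ⟨c, Or.inr hc⟩
      ⟨d, hd.1.1, by rintro (h | h); exacts [hd.1.2 h, hd.2 h]⟩
    rcases ha with rfl | ha
    · have := ht u (hC huC).1 b hb.1 htu hab
      exact absurd (Or.inr (this ▸ huC)) hb.2
    · exact ⟨a, ha, b, ⟨⟨hb.1, fun h => hb.2 (Or.inl h)⟩, fun h => hb.2 (Or.inr h)⟩, hab⟩
  · obtain ⟨a, ha, b, hb, hab⟩ := h C (hC.trans Set.sdiff_subset) ⟨c, hc⟩ ⟨d, hd.1.1, hd.2⟩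
    refine ⟨a, ha, b, ⟨⟨hb.1, ?_⟩, hb.2⟩, hab⟩
    rintro rfl
    exact hu ⟨a, ha, hab.symm⟩

/-- An end of a longest path works: by maximality each neighbour lies on the path, and by acyclicity
it is then the second vertex. -/
theorem IsAcyclic.exists_subsingleton_neighborSet [Finite N] [Nonempty N] (hG : G.IsAcyclic) :
    ∃ t, (G.neighborSet t).Subsingleton := by
  have ⟨u, v, p, hp, hmax⟩ := Walk.exists_isPath_forall_isPath_length_le_length G
  have key : ∀ w, G.Adj u w → w = p.snd := fun w hadj => by
    apply hG.eq_snd_of_adj_start hp hadj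
    have : ¬(p.cons hadj.symm).IsPath := by grind [Walk.length_cons]
    grind [hp.cons]
  exact ⟨u, fun w hw w' hw' => (key w hw).trans (key w' hw').symm⟩

theorem IsAcyclic.exists_leaf_in (hG : G.IsAcyclic) {s : Finset N} (hs : s.Nonempty) :
    ∃ t ∈ s, ∀ w ∈ s, ∀ w' ∈ s, G.Adj t w → G.Adj t w' → w = w' := by
  have : Nonempty (s : Set N) := hs.to_subtype
  obtain ⟨t, ht⟩ := (hG.induce (s : Set N)).exists_subsingleton_neighborSet
  exact ⟨t, t.2, fun w hw w' hw' h h' => congrArg Subtype.val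
    (ht (x := ⟨w, hw⟩) h (y := ⟨w', hw'⟩) h')⟩

/-- The bags over a finite part of a forest can be enumerated so that each bag meets the union of
its predecessors inside the intersection of two adjacent bags. -/
theorem IsAcyclic.exists_bag_enumeration {V : Type*} [DecidableEq V] [DecidableEq N]
    (hG : G.IsAcyclic) (χ : N → Finset V) (s : Finset N)
    (hconn : ∀ x, G.EdgeConnectedOn {t | t ∈ s ∧ x ∈ χ t}) :
    ∃ B : ℕ → Finset V, (∀ i < s.card, ∃ t ∈ s, B i = χ t) ∧ (∀ t ∈ s, ∃ i < s.card, B i = χ t) ∧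
      ∀ i < s.card, B i ∩ (Finset.range i).biUnion B = ∅ ∨
        ∃ t u, G.Adj t u ∧ B i ∩ (Finset.range i).biUnion B ⊆ χ t ∩ χ u := by
  induction hn : s.card generalizing s with
  | zero =>
    obtain rfl := Finset.card_eq_zero.1 hn
    exact ⟨fun _ => ∅, by simp⟩
  | succ n ih =>
    -- A leaf is enumerated last, after the bags of the remaining nodes.
    obtain ⟨t, hts, ht⟩ := hG.exists_leaf_in (Finset.card_pos.1 (by omega : 0 < s.card))
    have hcard : (s.erase t).card = n := by rw [Finset.card_erase_of_mem hts]; omega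
    obtain ⟨B, hB1, hB2, hB3⟩ := ih (s.erase t) (fun x => by
      have := (hconn x).diff_leaf (t := t) (fun w hw w' hw' => ht w hw.1 w' hw'.1)
      convert this using 1
      ext u
      simp only [Finset.mem_erase, Set.mem_ofPred_eq, Set.mem_sdiff, Set.mem_singleton_iff]
      tauto) hcard
    have hlt : ∀ i < n, Function.update B n (χ t) i = B i := fun i hi =>
      Function.update_of_ne hi.ne _ _
    have hU : ∀ i ≤ n, (Finset.range i).biUnion (Function.update B n (χ t)) =
        (Finset.range i).biUnion B := fun i hi =>
      Finset.biUnion_congr rfl fun j hj => hlt j (by have := Finset.mem_range.1 hj; omega)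
    refine ⟨Function.update B n (χ t), fun i hi => ?_, fun u hu => ?_, fun i hi => ?_⟩
    · rcases Nat.lt_succ_iff_lt_or_eq.1 hi with h | rfl
      · obtain ⟨u, hu, h'⟩ := hB1 i h
        exact ⟨u, Finset.mem_of_mem_erase hu, by rw [hlt i h, h']⟩
      · exact ⟨t, hts, by simp⟩
    · by_cases hut : u = t
      · exact ⟨n, by omega, by simp [hut]⟩
      · obtain ⟨i, hi, h'⟩ := hB2 u (Finset.mem_erase.2 ⟨hut, hu⟩)
        exact ⟨i, by omega, by rw [hlt i hi, h']⟩
    · rw [hU i (by omega)]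
      rcases Nat.lt_succ_iff_lt_or_eq.1 hi with h | rfl
      · rw [hlt i h]; exact hB3 i h
      · rw [Function.update_self]
        -- A variable shared with an earlier bag lives at `t` and at another node, so cutting off
        -- `{t}` shows that it also lives at a neighbour of `t`. The leaf has only one neighbour,
        -- which serves all shared variables.
        have key : ∀ x ∈ χ t ∩ (Finset.range i).biUnion B, ∃ w ∈ s, G.Adj t w ∧ x ∈ χ w := by
          intro x hx
          obtain ⟨hxt, hx⟩ := Finset.mem_inter.1 hx
          obtain ⟨j, hj, hxj⟩ := Finset.mem_biUnion.1 hx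
          obtain ⟨u, hu, hju⟩ := hB1 j (Finset.mem_range.1 hj)
          obtain ⟨hut, hus⟩ := Finset.mem_erase.1 hu
          obtain ⟨a, rfl, b, hb, hab⟩ := hconn x {t} (by simp [hts, hxt]) ⟨t, rfl⟩
            ⟨u, ⟨hus, hju ▸ hxj⟩, hut⟩
          exact ⟨b, hb.1.1, hab, hb.1.2⟩
        rcases (χ t ∩ (Finset.range i).biUnion B).eq_empty_or_nonempty with h | ⟨x, hx⟩
        · exact Or.inl h
        · obtain ⟨w, hw, htw, -⟩ := key x hx
          refine Or.inr ⟨t, w, htw, fun y hy => ?_⟩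
          obtain ⟨w', hw', htw', hyw⟩ := key y hy
          rw [ht w hw w' hw' htw htw']
          exact Finset.mem_inter.2 ⟨(Finset.mem_inter.1 hy).1, hyw⟩

end SimpleGraph

namespace CQ

open Finset

/-! ### Entropy of the uniform distribution on a relation -/

section Entropy

variable {α D : Type*}

/-- Jensen's inequality for the logarithm on the classes of an equivalence relation. -/
theorem sum_log_add_log_card_le {β : Type*} (P : Finset β) (r : β → β → Prop)
    [DecidableRel r] (hr : Equivalence r) (u : β → ℝ) (hu : ∀ p ∈ P, 0 < u p) :
    ∑ p ∈ P, (Real.log (u p) + Real.log #{q ∈ P | r p q}) ≤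
      ∑ p ∈ P, Real.log (∑ q ∈ P with r p q, u q) := by
  have hA : ∀ p ∈ P, 0 < ∑ q ∈ P with r p q, u q := fun p hp =>
    Finset.sum_pos (fun q hq => hu q (mem_filter.1 hq).1) ⟨p, mem_filter.2 ⟨hp, hr.refl p⟩⟩
  have hn : ∀ p ∈ P, (0 : ℝ) < #{q ∈ P | r p q} := fun p hp => by
    exact_mod_cast card_pos.2 ⟨p, mem_filter.2 ⟨hp, hr.refl p⟩⟩
  -- The ratios average to 1 over each class, so `log x ≤ x - 1` sums to the claim.
  have hsum : ∑ p ∈ P, u p * #{q ∈ P | r p q} / ∑ q ∈ P with r p q, u q = #P := by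
    have h1 : ∀ p ∈ P, u p * #{q ∈ P | r p q} / ∑ q ∈ P with r p q, u q =
        ∑ q ∈ P, if r p q then u p / ∑ q' ∈ P with r q q', u q' else 0 := by
      intro p _
      rw [← sum_filter, mul_comm, mul_div_assoc, ← nsmul_eq_mul, ← sum_const]
      refine sum_congr rfl fun q hq => ?_
      have hpq := (mem_filter.1 hq).2
      have : ({q' ∈ P | r p q'} : Finset β) = {q' ∈ P | r q q'} :=
        filter_congr fun q' _ => ⟨hr.trans (hr.symm hpq), hr.trans hpq⟩
      rw [this]
    rw [sum_congr rfl h1, sum_comm, card_eq_sum_ones, Nat.cast_sum]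
    refine sum_congr rfl fun q hq => ?_
    rw [← sum_filter, ← sum_div]
    have : ({p ∈ P | r p q} : Finset β) = {p ∈ P | r q p} :=
      filter_congr fun p _ => ⟨hr.symm, hr.symm⟩
    rw [this, div_self (hA q hq).ne', Nat.cast_one]
  have hle : ∑ p ∈ P, (Real.log (u p) + Real.log #{q ∈ P | r p q} -
      Real.log (∑ q ∈ P with r p q, u q)) ≤
      ∑ p ∈ P, (u p * #{q ∈ P | r p q} / (∑ q ∈ P with r p q, u q) - 1) := by
    refine sum_le_sum fun p hp => ?_
    rw [← Real.log_mul (hu p hp).ne' (hn p hp).ne',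
      ← Real.log_div (mul_pos (hu p hp) (hn p hp)).ne' (hA p hp).ne']
    exact Real.log_le_sub_one_of_pos (div_pos (mul_pos (hu p hp) (hn p hp)) (hA p hp))
  rw [sum_sub_distrib, sum_sub_distrib, hsum] at hle
  simpa using hle

/-- Two tuples agree on a set of attributes. -/
def Agree (X : Finset α) (p q : α → D) : Prop := ∀ x ∈ X, p x = q x

instance [DecidableEq D] (X : Finset α) : DecidableRel (Agree (D := D) X) := fun _ _ =>
  inferInstanceAs (Decidable (∀ x ∈ X, _))

theorem agree_equivalence (X : Finset α) : Equivalence (Agree (D := D) X) where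
  refl _ _ _ := rfl
  symm h x hx := (h x hx).symm
  trans h h' x hx := (h x hx).trans (h' x hx)

theorem agree_union [DecidableEq α] {X Y : Finset α} {p q : α → D} :
    Agree (X ∪ Y) p q ↔ Agree X p q ∧ Agree Y p q := by
  simp only [Agree, mem_union, or_imp, forall_and]

variable [DecidableEq D]

/-- The number of tuples of `P` that agree with `p` on `X`. -/
def agreeCard (P : Finset (α → D)) (X : Finset α) (p : α → D) : ℕ := #{q ∈ P | Agree X p q}

theorem agreeCard_pos {P : Finset (α → D)} {p : α → D} (hp : p ∈ P) (X : Finset α) :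
    0 < agreeCard P X p :=
  card_pos.2 ⟨p, mem_filter.2 ⟨hp, (agree_equivalence X).refl p⟩⟩

theorem agreeCard_congr {P : Finset (α → D)} {X : Finset α} {p q : α → D} (h : Agree X p q) :
    agreeCard P X p = agreeCard P X q := by
  unfold agreeCard
  congr 1
  exact filter_congr fun q' _ => ⟨(agree_equivalence X).trans ((agree_equivalence X).symm h),
    (agree_equivalence X).trans h⟩

/-- The entropy of the marginal on `X` of the uniform distribution on `P`. -/
noncomputable def entropy (P : Finset (α → D)) (X : Finset α) : ℝ :=
  Real.log #P - (∑ p ∈ P, Real.log (agreeCard P X p)) / #P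

theorem entropy_empty {P : Finset (α → D)} (hP : P.Nonempty) : entropy P ∅ = 0 := by
  have : (#P : ℝ) ≠ 0 := by exact_mod_cast hP.card_pos.ne'
  simp [entropy, agreeCard, Agree, this]

theorem entropy_univ [Fintype α] (P : Finset (α → D)) : entropy P univ = Real.log #P := by
  have : ∀ p ∈ P, Real.log (agreeCard P univ p) = 0 := by
    intro p hp
    have : ({q ∈ P | Agree univ p q} : Finset (α → D)) = {p} := by
      ext q
      simp only [mem_filter, mem_singleton]
      constructor
      · exact fun h => funext fun x => (h.2 x (mem_univ x)).symm
      · rintro rfl; exact ⟨hp, fun _ _ => rfl⟩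
    simp [agreeCard, this]
  simp [entropy, sum_eq_zero this]

/-- Jensen on the classes of agreement on `Z ∪ X`, with weights `n_{ZY} / n_{ZXY}`, where `n` counts
agreeing tuples, reduces this to a bound by `n_Z` on the class sums. The case `X = Y` is
monotonicity. -/
theorem entropy_submodular [DecidableEq α] (P : Finset (α → D)) (Z X Y : Finset α) :
    entropy P (Z ∪ X ∪ Y) + entropy P Z ≤ entropy P (Z ∪ X) + entropy P (Z ∪ Y) := by
  have hpos : ∀ X, ∀ p ∈ P, (0 : ℝ) < agreeCard P X p := fun X p hp => by
    exact_mod_cast agreeCard_pos hp X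
  have key := sum_log_add_log_card_le P (Agree (Z ∪ X)) (agree_equivalence _)
    (fun q => agreeCard P (Z ∪ Y) q / agreeCard P (Z ∪ X ∪ Y) q)
    (fun p hp => div_pos (hpos _ p hp) (hpos _ p hp))
  have hle : ∀ p ∈ P, ∑ q ∈ P with Agree (Z ∪ X) p q,
      ((agreeCard P (Z ∪ Y) q : ℝ) / agreeCard P (Z ∪ X ∪ Y) q) ≤ agreeCard P Z p := by
    intro p hp
    have h1 : ∀ q ∈ ({q ∈ P | Agree (Z ∪ X) p q} : Finset (α → D)),
        ((agreeCard P (Z ∪ Y) q : ℝ) / agreeCard P (Z ∪ X ∪ Y) q) =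
        ∑ r ∈ P with Agree Z p r, if Agree (Z ∪ Y) q r then
          ((agreeCard P (Z ∪ X ∪ Y) q : ℝ))⁻¹ else 0 := by
      intro q hq
      rw [← sum_filter, sum_const, nsmul_eq_mul, div_eq_mul_inv, filter_filter, agreeCard]
      congr 3
      refine filter_congr fun r _ => ⟨fun h => ⟨?_, h⟩, fun h => h.2⟩
      exact (agree_equivalence Z).trans (agree_union.1 (mem_filter.1 hq).2).1 (agree_union.1 h).1
    rw [sum_congr rfl h1, sum_comm, agreeCard, card_eq_sum_ones, Nat.cast_sum]
    -- For fixed `r`, the tuples `q` that contribute lie in one class of agreement on `Z ∪ X ∪ Y`,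
    -- each with weight one over the size of that class.
    refine sum_le_sum fun r _ => ?_
    rw [← sum_filter, filter_filter, Nat.cast_one]
    rcases (P.filter fun q => Agree (Z ∪ X) p q ∧ Agree (Z ∪ Y) q r).eq_empty_or_nonempty
      with h | ⟨q₀, hq₀⟩
    · simp [h]
    · have hq₀' := mem_filter.1 hq₀
      have hcl : ∀ q, Agree (Z ∪ X) p q ∧ Agree (Z ∪ Y) q r → Agree (Z ∪ X ∪ Y) q₀ q := by
        intro q hq
        refine agree_union.2 ⟨(agree_equivalence _).trans
          ((agree_equivalence _).symm hq₀'.2.1) hq.1, ?_⟩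
        exact (agree_equivalence _).trans (agree_union.1 hq₀'.2.2).2
          ((agree_equivalence _).symm (agree_union.1 hq.2).2)
      calc _ = ∑ q ∈ P with Agree (Z ∪ X) p q ∧ Agree (Z ∪ Y) q r,
              ((agreeCard P (Z ∪ X ∪ Y) q₀ : ℝ))⁻¹ :=
            sum_congr rfl fun q hq => by rw [agreeCard_congr (hcl q (mem_filter.1 hq).2)]
        _ ≤ 1 := by
          rw [sum_const, nsmul_eq_mul, ← div_eq_mul_inv, div_le_one (hpos _ q₀ hq₀'.1)]
          exact_mod_cast card_le_card (monotone_filter_right _ fun q _ hq => hcl q hq)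
  have key' : ∑ p ∈ P, (Real.log (agreeCard P (Z ∪ Y) p) - Real.log (agreeCard P (Z ∪ X ∪ Y) p) +
      Real.log (agreeCard P (Z ∪ X) p)) ≤ ∑ p ∈ P, Real.log (agreeCard P Z p) := by
    calc _ = _ := sum_congr rfl fun p hp => by
            rw [← Real.log_div (hpos _ p hp).ne' (hpos _ p hp).ne']; rfl
      _ ≤ _ := key
      _ ≤ _ := sum_le_sum fun p hp => Real.log_le_log
            (Finset.sum_pos (fun q hq => div_pos (hpos _ q (mem_filter.1 hq).1)
              (hpos _ q (mem_filter.1 hq).1))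
              ⟨p, mem_filter.2 ⟨hp, (agree_equivalence _).refl p⟩⟩) (hle p hp)
  rw [sum_add_distrib, sum_sub_distrib] at key'
  have := div_le_div_of_nonneg_right key' (Nat.cast_nonneg (α := ℝ) #P)
  rw [add_div, sub_div] at this
  unfold entropy
  linarith

end Entropy

open scoped NNReal

/-! ### Sums of maximum functions below a polymatroid -/

section Polymatroid

variable {α : Type*} [DecidableEq α] {h : Finset α → ℝ}

theorem sum_update_of_eq_zero [Fintype α] {β M : Type*} [AddCommMonoid M] (a : α → β) (n : α)
    (b : β) (F : β → M) (hF : F (a n) = 0) :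
    ∑ k, F (Function.update a n b k) = F b + ∑ k, F (a k) := by
  rw [← add_sum_erase _ _ (mem_univ n), ← add_sum_erase _ (fun k => F (a k)) (mem_univ n), hF,
    zero_add, Function.update_self]
  congr 1
  exact sum_congr rfl fun k hk => by rw [Function.update_of_ne (ne_of_mem_erase hk)]

theorem sup_zero_eq_zero {α : Type*} (X : Finset α) : X.sup (0 : α → ℝ≥0) = 0 := X.sup_bot

/-- A sum of maximum functions below the polymatroid `h(· | Cᶜ)` which has the same values on
singletons and on the whole set. -/
theorem exists_sum_sup_le_conditional [Fintype α]
    (hsub : ∀ Z X Y, h (Z ∪ X ∪ Y) + h Z ≤ h (Z ∪ X) + h (Z ∪ Y)) (C : Finset α) :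
    ∃ a : α → α → ℝ≥0, (∀ k ∉ C, a k = 0) ∧
      (∀ X : Finset α, ∑ k, ((X.sup (a k) : ℝ≥0) : ℝ) ≤ h (Cᶜ ∪ X) - h Cᶜ) ∧
      (∑ k, (a k k : ℝ) = h univ - h Cᶜ) ∧ ∀ x, ∑ k, (a k x : ℝ) = h (Cᶜ ∪ {x}) - h Cᶜ := by
  induction C using Finset.induction_on with
  | empty =>
    exact ⟨0, by simp, fun X => by simp [sup_zero_eq_zero, union_eq_left.2 (subset_univ X)],
      by simp, by simp⟩
  | insert n C hn ih =>
    obtain ⟨a, ha0, ha1, ha2, ha3⟩ := ih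
    obtain ⟨T, hT⟩ : ∃ T, T = (insert n C)ᶜ := ⟨_, rfl⟩
    have hTC : Cᶜ = T ∪ {n} := by
      ext x
      by_cases hx : x = n <;> simp [hT, hx, hn]
    rw [← hT]
    rw [hTC] at ha1 ha2 ha3
    -- The new row is the conditional mutual information `b i = I(i; n | T)`. By the chain rule,
    -- `h(X | T) = h(X | T ∪ {n}) + I(X; n | T)`; the last term dominates `b i` for every `i ∈ X`,
    -- with equality for a singleton. Since `b n = h({n} | T)`, the diagonal sum telescopes.
    have hb : ∀ i, 0 ≤ h (T ∪ {n}) - h T - (h (T ∪ {i} ∪ {n}) - h (T ∪ {i})) := fun i => by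
      linarith [hsub T {i} {n}]
    obtain ⟨b, hb⟩ : ∃ b : α → ℝ≥0, ∀ i, (b i : ℝ) =
        h (T ∪ {n}) - h T - (h (T ∪ {i} ∪ {n}) - h (T ∪ {i})) := ⟨fun i => ⟨_, hb i⟩, fun _ => rfl⟩
    have hsup : ∀ X : Finset α, ((X.sup b : ℝ≥0) : ℝ) ≤
        h (T ∪ {n}) - h T - (h (T ∪ X ∪ {n}) - h (T ∪ X)) := by
      intro X
      have h0 : 0 ≤ h (T ∪ {n}) - h T - (h (T ∪ X ∪ {n}) - h (T ∪ X)) := by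
        linarith [hsub T X {n}]
      lift h (T ∪ {n}) - h T - (h (T ∪ X ∪ {n}) - h (T ∪ X)) to ℝ≥0 using h0 with c hc
      refine NNReal.coe_le_coe.2 (Finset.sup_le fun i hi => ?_)
      · rw [← NNReal.coe_le_coe, hb, hc]
        have := hsub (T ∪ {i}) X {n}
        rw [union_assoc T {i} X, union_eq_right.2 (singleton_subset_iff.2 hi)] at this
        linarith
    have han : a n = 0 := ha0 n hn
    refine ⟨Function.update a n b, fun k hk => ?_, fun X => ?_, ?_, fun x => ?_⟩
    · rw [mem_insert, not_or] at hk
      rw [Function.update_of_ne hk.1, ha0 k hk.2]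
    · rw [sum_update_of_eq_zero a n b (fun c => ((X.sup c : ℝ≥0) : ℝ))
        (by simp [han, sup_zero_eq_zero])]
      have h1 := ha1 X
      have h2 := hsup X
      rw [union_right_comm] at h1
      linarith
    · have : ∀ k, ((Function.update a n b k k : ℝ≥0) : ℝ) =
          Function.update (fun k => (a k k : ℝ)) n (b n) k := by
        intro k
        by_cases hk : k = n
        · subst hk; simp
        · simp [hk]
      rw [sum_congr rfl fun k _ => this k,
        sum_update_of_eq_zero (fun k => (a k k : ℝ)) n _ (fun c => c) (by simp [han])]
      simp only [ha2, hb, union_assoc, union_idempotent]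
      ring
    · rw [sum_update_of_eq_zero a n b (fun c => (c x : ℝ)) (by simp [han]), ha3, hb,
        union_right_comm]
      ring

/-- Below every polymatroid there is a sum of maximum functions with the same value on singletons
and on the whole set. -/
theorem exists_sum_sup_le [Fintype α]
    (hsub : ∀ Z X Y, h (Z ∪ X ∪ Y) + h Z ≤ h (Z ∪ X) + h (Z ∪ Y)) (h0 : h ∅ = 0) :
    ∃ a : α → α → ℝ≥0, (∀ X : Finset α, ∑ k, ((X.sup (a k) : ℝ≥0) : ℝ) ≤ h X) ∧
      (∑ k, (a k k : ℝ) = h univ) ∧ ∀ x, ∑ k, (a k x : ℝ) = h {x} := by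
  obtain ⟨a, -, ha⟩ := exists_sum_sup_le_conditional hsub univ
  exact ⟨a, by simpa [h0] using ha⟩

/-- Below every polymatroid there is a modular function with the same value on the whole set. -/
theorem exists_modular_le [Fintype α]
    (hsub : ∀ Z X Y, h (Z ∪ X ∪ Y) + h Z ≤ h (Z ∪ X) + h (Z ∪ Y)) (h0 : h ∅ = 0) :
    ∃ a : α → α → ℝ≥0, (∀ k x, x ≠ k → a k x = 0) ∧
      (∀ X : Finset α, ∑ k, ((X.sup (a k) : ℝ≥0) : ℝ) ≤ h X) ∧ ∑ k, (a k k : ℝ) = h univ := by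
  obtain ⟨a, ha1, ha2, -⟩ := exists_sum_sup_le hsub h0
  -- Keeping only the diagonal lowers the maxima but not the diagonal sum, which is already `h
  -- univ`.
  refine ⟨fun k x => if x = k then a k x else 0, fun k x hx => if_neg hx, fun X => ?_, ?_⟩
  · refine le_trans (sum_le_sum fun k _ => NNReal.coe_le_coe.2 ?_) (ha1 X)
    refine sup_mono_fun fun x _ => ?_
    dsimp only
    split_ifs
    exacts [le_rfl, zero_le]
  · simpa using ha2

end Polymatroid

/-! ### Entropy bound for assignments glued along bags -/

section EntropyBound

theorem biUnion_range_succ {V : Type*} [DecidableEq V] (B : ℕ → Finset V) (n : ℕ) :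
    (range (n + 1)).biUnion B = (range n).biUnion B ∪ (B n \ (range n).biUnion B) := by
  rw [range_add_one, biUnion_insert, union_sdiff_self_eq_union, union_comm]

theorem agree_image {V₁ V₂ D : Type*} [DecidableEq V₁] {φ : V₂ → V₁} {X : Finset V₂}
    {p q : V₁ → D} :
    Agree (X.image φ) p q ↔ ∀ y ∈ X, p (φ y) = q (φ y) := by
  simp [Agree]

variable {V₁ V₂ D : Type*} [DecidableEq V₂] [DecidableEq D] [Fintype V₂] [Fintype D]

/-- The assignments that look like tuples of `P` along `φ` on each of the first `n` bags, and
that have a default value outside these bags. -/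
def partialAssignments (P : Finset (V₁ → D)) (φ : V₂ → V₁) (p₀ : V₁ → D) (B : ℕ → Finset V₂)
    (n : ℕ) : Finset (V₂ → D) :=
  {f | (∀ i < n, ∃ p ∈ P, ∀ y ∈ B i, f y = p (φ y)) ∧
    ∀ y ∉ (range n).biUnion B, f y = p₀ (φ y)}

variable {P : Finset (V₁ → D)} {φ : V₂ → V₁} {p₀ : V₁ → D} {B : ℕ → Finset V₂}

theorem mem_partialAssignments {n : ℕ} {f : V₂ → D} : f ∈ partialAssignments P φ p₀ B n ↔
    (∀ i < n, ∃ p ∈ P, ∀ y ∈ B i, f y = p (φ y)) ∧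
      ∀ y ∉ (range n).biUnion B, f y = p₀ (φ y) := by
  simp [partialAssignments]

theorem default_mem_partialAssignments (hp₀ : p₀ ∈ P) (n : ℕ) :
    p₀ ∘ φ ∈ partialAssignments P φ p₀ B n :=
  mem_partialAssignments.2 ⟨fun _ _ => ⟨p₀, hp₀, fun _ _ => rfl⟩, fun _ _ => rfl⟩

/-- A partial assignment `f` and a tuple `q` that agree on the separator glue to an assignment on
one more bag. The result determines `f`, and determines `q` up to agreement on `φ(B n)`; dividing by
the size of that class makes up for the overcount. -/
theorem sum_extend_le [DecidableEq V₁] (W : V₂ → D → ℝ) (hW : ∀ y d, 0 ≤ W y d) (n : ℕ) :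
    ∑ f ∈ partialAssignments P φ p₀ B n, (∏ y ∈ (range n).biUnion B, W y (f y)) *
      ∑ q ∈ P with ∀ y ∈ B n ∩ (range n).biUnion B, f y = q (φ y),
        (∏ y ∈ B n \ (range n).biUnion B, W y (q (φ y))) / agreeCard P ((B n).image φ) q ≤
    ∑ f ∈ partialAssignments P φ p₀ B (n + 1), ∏ y ∈ (range (n + 1)).biUnion B, W y (f y) := by
  set U := (range n).biUnion B with hU
  simp_rw [mul_sum]
  rw [sum_sigma']
  let g : (Σ _ : V₂ → D, V₁ → D) → V₂ → D := fun x y =>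
    if y ∈ U then x.1 y else if y ∈ B n then x.2 (φ y) else p₀ (φ y)
  set s := (partialAssignments P φ p₀ B n).sigma
    fun f => ({q ∈ P | ∀ y ∈ B n ∩ U, f y = q (φ y)} : Finset (V₁ → D)) with hs
  have hgU : ∀ x y, y ∈ U → g x y = x.1 y := fun x y hy => if_pos hy
  have hgB : ∀ x ∈ s, ∀ y ∈ B n, g x y = x.2 (φ y) := by
    intro x hx y hy
    by_cases hyU : y ∈ U
    · rw [hgU x y hyU]
      exact (mem_filter.1 (mem_sigma.1 hx).2).2 y (mem_inter.2 ⟨hy, hyU⟩)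
    · simp [g, hyU, hy]
  have hBU : ∀ i < n, B i ⊆ U := fun i hi => subset_biUnion_of_mem B (mem_range.2 hi)
  have hmaps : ∀ x ∈ s, g x ∈ partialAssignments P φ p₀ B (n + 1) := by
    intro x hx
    obtain ⟨hx1, hx2⟩ := mem_sigma.1 hx
    refine mem_partialAssignments.2 ⟨fun i hi => ?_, fun y hy => ?_⟩
    · rcases Nat.lt_succ_iff_lt_or_eq.1 hi with h | rfl
      · obtain ⟨p, hp, hpy⟩ := (mem_partialAssignments.1 hx1).1 i h
        exact ⟨p, hp, fun y hy => (hgU x y (hBU i h hy)).trans (hpy y hy)⟩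
      · exact ⟨x.2, (mem_filter.1 hx2).1, hgB x hx⟩
    · rw [biUnion_range_succ, union_sdiff_self_eq_union, mem_union, not_or] at hy
      have hyU : y ∉ U := hy.1
      simp only [g, hyU, hy.2, if_false]
  rw [← sum_fiberwise_of_maps_to hmaps]
  refine sum_le_sum fun f' _ => ?_
  have hW' : 0 ≤ ∏ y ∈ (range (n + 1)).biUnion B, W y (f' y) := prod_nonneg fun y _ => hW y _
  rcases (s.filter fun x => g x = f').eq_empty_or_nonempty with h | ⟨x₀, hx₀⟩
  · rw [h, sum_empty]; exact hW'
  obtain ⟨hx₀s, hx₀g⟩ := mem_filter.1 hx₀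
  have hx₀P : x₀.2 ∈ P := (mem_filter.1 (mem_sigma.1 hx₀s).2).1
  have hagree : ∀ x ∈ s.filter fun x => g x = f', Agree ((B n).image φ) x₀.2 x.2 := by
    intro x hx
    obtain ⟨hxs, hxg⟩ := mem_filter.1 hx
    refine agree_image.2 fun y hy => ?_
    rw [← hgB x₀ hx₀s y hy, ← hgB x hxs y hy, hx₀g, hxg]
  have hterm : ∀ x ∈ s.filter fun x => g x = f', (∏ y ∈ U, W y (x.1 y)) *
      ((∏ y ∈ B n \ U, W y (x.2 (φ y))) / agreeCard P ((B n).image φ) x.2) =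
      (∏ y ∈ (range (n + 1)).biUnion B, W y (f' y)) / agreeCard P ((B n).image φ) x₀.2 := by
    intro x hx
    obtain ⟨hxs, rfl⟩ := mem_filter.1 hx
    rw [biUnion_range_succ, prod_union disjoint_sdiff, mul_div_assoc,
      agreeCard_congr (hagree x hx)]
    congr 1
    · exact prod_congr rfl fun y hy => by rw [hgU x y hy]
    · congr 1
      exact prod_congr rfl fun y hy => by rw [hgB x hxs y (mem_sdiff.1 hy).1]
  rw [sum_congr rfl hterm, sum_const, nsmul_eq_mul, ← mul_div_assoc, mul_div_right_comm]
  refine mul_le_of_le_one_left hW' ?_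
  rw [div_le_one (by exact_mod_cast agreeCard_pos hx₀P _)]
  norm_cast
  refine card_le_card_of_injOn (fun x => x.2) (fun x hx => ?_) fun x hx x' hx' hxx => ?_
  · exact mem_filter.2 ⟨(mem_filter.1 (mem_sigma.1 (mem_filter.1 hx).1).2).1, hagree x hx⟩
  · obtain ⟨hxs, hxg⟩ := mem_filter.1 hx
    obtain ⟨hxs', hxg'⟩ := mem_filter.1 hx'
    have h1 : x.1 = x'.1 := by
      funext y
      by_cases hy : y ∈ U
      · rw [← hgU x y hy, ← hgU x' y hy, hxg, hxg']
      · rw [(mem_partialAssignments.1 (mem_sigma.1 hxs).1).2 y hy,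
          (mem_partialAssignments.1 (mem_sigma.1 hxs').1).2 y hy]
    exact Sigma.ext h1 (heq_of_eq hxx)

/-- A variational inequality of Gibbs type. The unary weights `W` carry the induction: summing out
the last bag leaves a factor that depends only on the values on its separator, and if the separator
is a single variable this factor is again a unary weight. -/
theorem sum_entropy_add_le_log_sum [DecidableEq V₁] (hp₀ : p₀ ∈ P) (m : ℕ)
    (hS : ∀ i < m, #(B i ∩ (range i).biUnion B) ≤ 1) (W : V₂ → D → ℝ) (hW : ∀ y d, 0 ≤ W y d)
    (hWP : ∀ y, ∀ p ∈ P, 0 < W y (p (φ y))) :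
    ∑ i ∈ range m, (entropy P ((B i).image φ) -
      entropy P ((B i ∩ (range i).biUnion B).image φ)) +
      (∑ p ∈ P, ∑ y ∈ (range m).biUnion B, Real.log (W y (p (φ y)))) / #P ≤
    Real.log (∑ f ∈ partialAssignments P φ p₀ B m, ∏ y ∈ (range m).biUnion B, W y (f y)) := by
  have hP : (#P : ℝ) ≠ 0 := by exact_mod_cast (card_pos.2 ⟨p₀, hp₀⟩).ne'
  have hP0 : (0 : ℝ) < #P := by positivity
  have hpos : ∀ W : V₂ → D → ℝ, (∀ y d, 0 ≤ W y d) → (∀ y, ∀ p ∈ P, 0 < W y (p (φ y))) → ∀ n,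
      0 < ∑ f ∈ partialAssignments P φ p₀ B n, ∏ y ∈ (range n).biUnion B, W y (f y) :=
    fun W hW hWP n => sum_pos' (fun f _ => prod_nonneg fun y _ => hW y _)
      ⟨p₀ ∘ φ, default_mem_partialAssignments hp₀ n, prod_pos fun y _ => hWP y p₀ hp₀⟩
  induction m generalizing W with
  | zero =>
    have h := (card_pos.2 ⟨p₀ ∘ φ, default_mem_partialAssignments (φ := φ) (B := B) hp₀ 0⟩)
    simpa using Real.log_nonneg (by exact_mod_cast h :
      (1 : ℝ) ≤ #(partialAssignments P φ p₀ B 0))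
  | succ n ih =>
    have hext := sum_extend_le (P := P) (φ := φ) (p₀ := p₀) (B := B) W hW n
    have ih := ih fun i hi => hS i (by omega)
    have hSn := hS n (by omega)
    rw [biUnion_range_succ] at *
    set U := (range n).biUnion B with hU
    set S := B n ∩ U with hSdef
    let u : (V₁ → D) → ℝ := fun q =>
      (∏ y ∈ B n \ U, W y (q (φ y))) / agreeCard P ((B n).image φ) q
    have hu0 : ∀ q, 0 ≤ u q := fun q => div_nonneg (prod_nonneg fun y _ => hW y _) (by positivity)
    have hagp : ∀ X, ∀ p ∈ P, (0 : ℝ) < agreeCard P X p := fun X p hp => by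
      exact_mod_cast agreeCard_pos hp X
    have hu : ∀ p ∈ P, 0 < u p := fun p hp =>
      div_pos (prod_pos fun y _ => hWP y p hp) (hagp _ p hp)
    have hgibbs := sum_log_add_log_card_le P (Agree (S.image φ)) (agree_equivalence _) u hu
    have hlogu : ∀ p ∈ P, Real.log (u p) = ∑ y ∈ B n \ U, Real.log (W y (p (φ y))) -
        Real.log (agreeCard P ((B n).image φ) p) := fun p hp => by
      rw [Real.log_div (prod_pos fun y _ => hWP y p hp).ne' (hagp _ p hp).ne',
        Real.log_prod fun y _ => (hWP y p hp).ne']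
    have hA : ∀ p ∈ P, 0 < ∑ q ∈ P with Agree (S.image φ) p q, u q := fun p hp =>
      sum_pos (fun q hq => hu q (mem_filter.1 hq).1)
        ⟨p, mem_filter.2 ⟨hp, (agree_equivalence _).refl p⟩⟩
    have hstep : entropy P ((B n).image φ) - entropy P (S.image φ) +
        (∑ p ∈ P, ∑ y ∈ B n \ U, Real.log (W y (p (φ y)))) / #P ≤
        (∑ p ∈ P, Real.log (∑ q ∈ P with Agree (S.image φ) p q, u q)) / #P := by
      rw [sum_add_distrib, sum_congr rfl hlogu, sum_sub_distrib] at hgibbs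
      have := div_le_div_of_nonneg_right hgibbs hP0.le
      rw [add_div, sub_div] at this
      simp only [entropy]
      unfold agreeCard at this ⊢
      linarith
    rw [sum_range_succ]
    simp_rw [sum_union disjoint_sdiff]
    rw [sum_add_distrib, add_div]
    rcases Nat.le_one_iff_eq_zero_or_eq_one.1 hSn with h0 | h1
    -- With an empty separator the factor is a constant and splits off.
    · have hS0 : S = ∅ := card_eq_zero.1 h0
      have hL := ih W hW hWP
      have hAeq : ∀ p, (∑ q ∈ P with Agree (S.image φ) p q, u q) = ∑ q ∈ P, u q := by
        intro p; simp [hS0, Agree]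
      have hA0 : 0 < ∑ q ∈ P, u q := hAeq p₀ ▸ hA p₀ hp₀
      simp only [hAeq, sum_const, nsmul_eq_mul] at hstep
      rw [mul_div_cancel_left₀ _ hP] at hstep
      simp only [hS0, notMem_empty, false_imp_iff, implies_true, filter_true] at hext
      rw [← sum_mul] at hext
      have := Real.log_le_log (mul_pos (hpos W hW hWP n) hA0) hext
      rw [Real.log_mul (hpos W hW hWP n).ne' hA0.ne'] at this
      linarith
    · obtain ⟨s, hs⟩ := card_eq_one.1 h1
      have hsU : s ∈ U := (mem_inter.1 (hs ▸ mem_singleton_self s : s ∈ S)).2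
      let A : D → ℝ := fun d => ∑ q ∈ P with d = q (φ s), u q
      have hAeq : ∀ p, (∑ q ∈ P with Agree (S.image φ) p q, u q) = A (p (φ s)) := by
        intro p; simp [hs, Agree, A]
      have hAp : ∀ p ∈ P, 0 < A (p (φ s)) := fun p hp => hAeq p ▸ hA p hp
      have hA0 : ∀ d, 0 ≤ A d := fun d => sum_nonneg fun q _ => hu0 q
      -- The total weight `A` of the extensions over a value at `s` is absorbed into the weight of
      -- `s`.
      let W' : V₂ → D → ℝ := fun y d => W y d * if y = s then A d else 1
      have hW' : ∀ y d, 0 ≤ W' y d := fun y d => mul_nonneg (hW y d) (by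
        split_ifs
        exacts [hA0 d, zero_le_one])
      have hWP' : ∀ y, ∀ p ∈ P, 0 < W' y (p (φ y)) := fun y p hp => mul_pos (hWP y p hp) (by
        split_ifs with h
        exacts [h ▸ hAp p hp, zero_lt_one])
      have hL := ih W' hW' hWP'
      have hprod : ∀ f : V₂ → D, ∏ y ∈ U, W' y (f y) = (∏ y ∈ U, W y (f y)) * A (f s) := by
        intro f
        simp only [W', prod_mul_distrib, prod_ite_eq', hsU, if_true]
      have hlog : ∀ p ∈ P, ∑ y ∈ U, Real.log (W' y (p (φ y))) =
          ∑ y ∈ U, Real.log (W y (p (φ y))) + Real.log (A (p (φ s))) := by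
        intro p hp
        rw [← Real.log_prod fun y _ => (hWP' y p hp).ne', hprod fun y => p (φ y),
          Real.log_mul (prod_pos fun y _ => hWP y p hp).ne' (hAp p hp).ne',
          Real.log_prod fun y _ => (hWP y p hp).ne']
      rw [sum_congr rfl hlog, sum_add_distrib, add_div] at hL
      simp only [hAeq] at hstep
      have hext' : ∑ f ∈ partialAssignments P φ p₀ B n, ∏ y ∈ U, W' y (f y) ≤
          ∑ f ∈ partialAssignments P φ p₀ B (n + 1), ∏ y ∈ U ∪ B n \ U, W y (f y) := by
        refine le_trans (le_of_eq (sum_congr rfl fun f _ => ?_)) hext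
        rw [hprod f, hs]
        simp [A, u]
      have := Real.log_le_log (hpos W' hW' hWP' n) hext'
      linarith

/-- The entropy of the distribution glued from the marginals of the uniform distribution on `P`
along a sequence of bags is at most the entropy of the uniform distribution on all assignments
that look like tuples of `P` on each bag. -/
theorem sum_entropy_le_log_card [DecidableEq V₁] (hP : P.Nonempty) (m : ℕ)
    (hS : ∀ i < m, #(B i ∩ (range i).biUnion B) ≤ 1) :
    ∑ i ∈ range m, (entropy P ((B i).image φ) -
      entropy P ((B i ∩ (range i).biUnion B).image φ)) ≤
    Real.log #{f : V₂ → D | ∀ i < m, ∃ p ∈ P, ∀ y ∈ B i, f y = p (φ y)} := by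
  obtain ⟨p₀, hp₀⟩ := hP
  have h := sum_entropy_add_le_log_sum (φ := φ) hp₀ m hS (fun _ _ => 1) (fun _ _ => zero_le_one)
    fun _ _ _ => zero_lt_one
  simp only [Real.log_one, sum_const_zero, zero_div, add_zero, prod_const_one, sum_const,
    nsmul_eq_mul, mul_one] at h
  refine h.trans (Real.log_le_log ?_ ?_)
  · exact_mod_cast card_pos.2 ⟨p₀ ∘ φ, default_mem_partialAssignments hp₀ m⟩
  · exact_mod_cast card_le_card fun f hf =>
      mem_filter.2 ⟨mem_univ f, (mem_partialAssignments.1 hf).1⟩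

end EntropyBound

/-! ### Bit relations and their homomorphism counts -/

section BitRelation

variable {V₁ K : Type*} (tag : V₁ → K) (b : K → V₁ → ℕ) (M : ℕ)

/-- The coordinates attached to the variable `x`: its own tag, and the first `b k x` of the bits
with first index `k`. -/
def bitCoords (x : V₁) : Set (K ⊕ K × Fin M) :=
  {v | Sum.elim (fun k => k = tag x) (fun c => (c.2 : ℕ) < b c.1 x) v}

/-- All 0-1 assignments that vanish on the tags. -/
def bitBase (K : Type*) (M : ℕ) : Set (K ⊕ K × Fin M → Bool) :=
  Set.univ.pi (Sum.elim (fun _ => {false}) fun _ => Set.univ)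

variable {tag b M}

theorem inl_mem_bitCoords {x : V₁} {k : K} : Sum.inl k ∈ bitCoords tag b M x ↔ k = tag x :=
  Iff.rfl

theorem inr_mem_bitCoords {x : V₁} {c : K × Fin M} :
    Sum.inr c ∈ bitCoords tag b M x ↔ (c.2 : ℕ) < b c.1 x :=
  Iff.rfl

theorem mem_bitBase {g : K ⊕ K × Fin M → Bool} :
    g ∈ bitBase K M ↔ ∀ k, g (Sum.inl k) = false := by
  simp [bitBase, Set.mem_pi]

/-- This is the purpose of the tags: the summand of the disjoint union in which a value lies reveals
the variable it belongs to. -/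
theorem bitCoords_injective (htag : Function.Injective tag) :
    Function.Injective (bitCoords tag b M) := fun x x' h => by
  have : Sum.inl (tag x) ∈ bitCoords tag b M x' := h ▸ inl_mem_bitCoords.2 rfl
  exact htag (inl_mem_bitCoords.1 this)

open Classical in
/-- The bit with index `(k, j)` of a value, `false` if there is none. -/
noncomputable def bit (d : Σ s : Set (K ⊕ K × Fin M), (s → Bool)) (k : K) (j : ℕ) : Bool :=
  if h : ∃ hj : j < M, Sum.inr (k, ⟨j, hj⟩) ∈ d.1 then d.2 ⟨_, h.2⟩ else false

theorem bit_dotTuple (hM : ∀ k x, b k x ≤ M) (g : K ⊕ K × Fin M → Bool) {x : V₁} {k : K} {j : ℕ}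
    (hj : j < b k x) :
    bit (dotTuple (bitCoords tag b M) g x) k j = g (Sum.inr (k, ⟨j, hj.trans_le (hM k x)⟩)) :=
  dif_pos ⟨hj.trans_le (hM k x), hj⟩

theorem lt_of_bit_dotTuple {g : K ⊕ K × Fin M → Bool} {x : V₁} {k : K} {j : ℕ}
    (h : bit (dotTuple (bitCoords tag b M) g x) k j = true) : j < b k x := by
  by_contra hj
  have : ¬ ∃ hj : j < M, Sum.inr (k, ⟨j, hj⟩) ∈ (dotTuple (bitCoords tag b M) g x).1 :=
    fun h => hj h.2
  simp [bit, dif_neg this] at h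

theorem dotTuple_congr {W V D : Type*} {ψ : W → Set V} {g g' : V → D} {x : W}
    (h : ∀ v ∈ ψ x, g v = g' v) : dotTuple ψ g x = dotTuple ψ g' x := by
  unfold dotTuple
  congr 1
  exact funext fun v => h v v.2

theorem dotTuple_eq_of_bit_eq (hM : ∀ k x, b k x ≤ M) {g g' : K ⊕ K × Fin M → Bool}
    (hg : g ∈ bitBase K M) (hg' : g' ∈ bitBase K M) {x : V₁}
    (h : ∀ k j, j < b k x → bit (dotTuple (bitCoords tag b M) g x) k j =
      bit (dotTuple (bitCoords tag b M) g' x) k j) :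
    dotTuple (bitCoords tag b M) g x = dotTuple (bitCoords tag b M) g' x := by
  refine dotTuple_congr fun v hv => ?_
  rcases v with k | ⟨k, j⟩
  · rw [mem_bitBase.1 hg, mem_bitBase.1 hg']
  · have hv' : (j : ℕ) < b k x := inr_mem_bitCoords.1 hv
    have := h k j hv'
    rwa [bit_dotTuple hM g hv', bit_dotTuple hM g' hv'] at this

variable (tag b M) in
/-- The normal relation of bit tuples. -/
def bitRelation : Set (V₁ → Σ s : Set (K ⊕ K × Fin M), (s → Bool)) :=
  dotTuple (bitCoords tag b M) '' bitBase K M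

/-- For each `k`, a variable with maximal `b k` sees every bit with index `k` that is seen at all,
so all these bits can be chosen freely and recovered from the tuple. -/
theorem two_pow_le_ncard_bitRelation [Fintype V₁] [Fintype K] (hM : ∀ k x, b k x ≤ M) :
    2 ^ ∑ k, univ.sup (b k) ≤ (bitRelation tag b M).ncard := by
  classical
  let ext : ((Σ k, Fin (univ.sup (b k))) → Bool) → K ⊕ K × Fin M → Bool := fun g =>
    Sum.elim (fun _ => false)
      fun c => if h : (c.2 : ℕ) < univ.sup (b c.1) then g ⟨c.1, ⟨c.2, h⟩⟩ else false
  have hinj : Function.Injective fun g => dotTuple (bitCoords tag b M) (ext g) := by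
    intro g g' h
    funext ⟨k, j⟩
    obtain ⟨x, -, hx⟩ := Finset.lt_sup_iff.1 j.2
    have := congrArg (fun d => bit d k j) (congrFun h x)
    simpa only [bit_dotTuple hM _ hx, ext, Sum.elim_inr, j.2, dite_true] using this
  have hcard : Nat.card ((Σ k, Fin (univ.sup (b k))) → Bool) = 2 ^ ∑ k, univ.sup (b k) := by
    simp
  rw [← hcard, ← Set.ncard_univ, ← Set.ncard_image_of_injective _ hinj]
  refine Set.ncard_le_ncard ?_ (Set.toFinite _)
  rintro _ ⟨g, -, rfl⟩
  exact ⟨ext g, mem_bitBase.2 fun k => rfl, rfl⟩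

/-- Distinct variables see disjoint sets of bits, so choices made separately at each variable
combine into one base assignment. -/
theorem isProductRelation_bitRelation (htag : Function.Injective tag)
    (hb : ∀ k x, k ≠ tag x → b k x = 0) : IsProductRelation (bitRelation tag b M) := by
  classical
  refine ⟨fun x => (fun g => dotTuple (bitCoords tag b M) g x) '' bitBase K M,
    Set.Subset.antisymm ?_ fun p hp => ?_⟩
  · rintro _ ⟨g, hg, rfl⟩ x -
    exact ⟨g, hg, rfl⟩
  · choose g hg hgp using fun x => hp x (Set.mem_univ x)
    refine ⟨Sum.elim (fun _ => false) fun c =>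
      if h : ∃ x, c.1 = tag x then g h.choose (Sum.inr c) else false,
      mem_bitBase.2 fun k => rfl, funext fun x => (dotTuple_congr fun v hv => ?_).trans (hgp x)⟩
    rcases v with k | c
    · exact (mem_bitBase.1 (hg x) k).symm
    · have hc : c.1 = tag x := by
        by_contra h
        have := inr_mem_bitCoords.1 hv
        rw [hb _ _ h] at this
        exact Nat.not_lt_zero _ this
      have hex : ∃ x, c.1 = tag x := ⟨x, hc⟩
      have : hex.choose = x := htag (hex.choose_spec.symm.trans hc)
      rw [Sum.elim_inr, dif_pos hex, this]

variable {V₂ : Type*} {σ : Vocabulary} {Q₁ : Query σ V₁} {Q₂ : Query σ V₂}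

/-- Homomorphisms of queries. -/
def Query.IsHom (Q₂ : Query σ V₂) (Q₁ : Query σ V₁) (φ : V₂ → V₁) : Prop :=
  ∀ A ∈ Q₂.atoms, (⟨A.rel, φ ∘ A.vars⟩ : QAtom σ V₁) ∈ Q₁.atoms

variable (tag b M) in
/-- The assignments to the variables of a query that on every atom look like a tuple of
`bitRelation` along `φ`. -/
def bitAssignments (Q₂ : Query σ V₂) (φ : V₂ → V₁) :
    Set (V₂ → Σ s : Set (K ⊕ K × Fin M), (s → Bool)) :=
  {f | ∀ A ∈ Q₂.atoms, ∃ g ∈ bitBase K M,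
    ∀ y ∈ Set.range A.vars, f y = dotTuple (bitCoords tag b M) g (φ y)}

/-- The summand containing `f y` determines `φ y`. An atom of `Q₂` is sent to a tuple coming from
some atom of `Q₁`, and by injectivity of `bitCoords` that atom is its image under `φ`. -/
theorem exists_mem_bitAssignments {K : Type} [Finite K]
    {tag : V₁ → K} {b : K → V₁ → ℕ} (htag : Function.Injective tag)
    {f : V₂ → Σ s : Set (K ⊕ K × Fin M), (s → Bool)}
    (hf : f ∈ Q₂.hom (Q₁.induced (bitRelation tag b M))) :
    ∃ φ, Q₂.IsHom Q₁ φ ∧ f ∈ bitAssignments tag b M Q₂ φ := by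
  have key : ∀ A ∈ Q₂.atoms, ∃ v, (⟨A.rel, v⟩ : QAtom σ V₁) ∈ Q₁.atoms ∧ ∃ g ∈ bitBase K M,
      ∀ i, f (A.vars i) = dotTuple (bitCoords tag b M) g (v i) := by
    intro A hA
    obtain ⟨v, hv, _, ⟨g, hg, rfl⟩, hgf⟩ := Set.mem_iUnion₂.1 (hf A hA)
    exact ⟨v, hv, g, hg, fun i => (congrFun hgf i).symm⟩
  have hφ : ∀ y, ∃ x, (f y).1 = bitCoords tag b M x := by
    intro y
    obtain ⟨A, hA, i, rfl⟩ := Q₂.occurs y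
    obtain ⟨v, -, g, -, h⟩ := key A hA
    exact ⟨v i, by rw [h i]; rfl⟩
  choose φ hφ using hφ
  have hv : ∀ A ∈ Q₂.atoms, ∃ v, (⟨A.rel, v⟩ : QAtom σ V₁) ∈ Q₁.atoms ∧ φ ∘ A.vars = v ∧
      ∃ g ∈ bitBase K M, ∀ i, f (A.vars i) = dotTuple (bitCoords tag b M) g (v i) := by
    intro A hA
    obtain ⟨v, hv, g, hg, h⟩ := key A hA
    refine ⟨v, hv, funext fun i => bitCoords_injective (b := b) (M := M) htag ?_, g, hg, h⟩
    · rw [Function.comp_apply, ← hφ, h i]; rfl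
  refine ⟨φ, fun A hA => ?_, fun A hA => ?_⟩
  · obtain ⟨v, hv, rfl, -⟩ := hv A hA
    exact hv
  · obtain ⟨v, hv, rfl, g, hg, h⟩ := hv A hA
    refine ⟨g, hg, ?_⟩
    rintro _ ⟨i, rfl⟩
    exact h i

/-- Two distinct variables of a clique share an atom, on which `f` comes from a single base
assignment. -/
theorem bitAssignments_agree (hM : ∀ k x, b k x ≤ M) {φ : V₂ → V₁}
    {f : V₂ → Σ s : Set (K ⊕ K × Fin M), (s → Bool)} (hf : f ∈ bitAssignments tag b M Q₂ φ)
    {X : Set V₂} (hX : Q₂.gaifman.IsClique X) {y y' : V₂} (hy : y ∈ X) (hy' : y' ∈ X) {k : K}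
    {j : ℕ} (hj : j < b k (φ y)) (hj' : j < b k (φ y')) : bit (f y) k j = bit (f y') k j := by
  by_cases h : y = y'
  · rw [h]
  · obtain ⟨-, A, hA, hyA, hyA'⟩ := hX hy hy' h
    obtain ⟨g, -, hg⟩ := hf A hA
    rw [hg y hyA, hg y' hyA', bit_dotTuple hM g hj, bit_dotTuple hM g hj']

theorem ncard_bitAssignments_le [DecidableEq V₂] [Fintype K] (hM : ∀ k x, b k x ≤ M)
    (φ : V₂ → V₁) (B : ℕ → Finset V₂) (m : ℕ)
    (hclique : ∀ i < m, Q₂.gaifman.IsClique (B i : Set V₂)) (hcover : ∀ y, ∃ i < m, y ∈ B i) :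
    (bitAssignments tag b M Q₂ φ).ncard ≤ 2 ^ ∑ i : Fin m, ∑ k, ((B i).sup (fun y => b k (φ y)) -
      (B i ∩ (range i).biUnion B).sup fun y => b k (φ y)) := by
  classical
  -- The code of `f` records, for each bag and each `k`, only the bits beyond those visible on the
  -- separator. All variables of the bag that see a bit agree on it, so asking whether some variable
  -- shows `true` reads it off.
  let F : (V₂ → Σ s : Set (K ⊕ K × Fin M), (s → Bool)) →
      (Σ i : Fin m, Σ k, Fin ((B i).sup (fun y => b k (φ y)) -
        (B i ∩ (range i).biUnion B).sup fun y => b k (φ y))) → Bool := fun f c =>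
    decide (∃ y ∈ B c.1, bit (f y) c.2.1
      (c.2.2 + (B c.1 ∩ (range c.1).biUnion B).sup fun y => b c.2.1 (φ y)) = true)
  have hform : ∀ f ∈ bitAssignments tag b M Q₂ φ, ∀ y, ∃ g ∈ bitBase K M,
      f y = dotTuple (bitCoords tag b M) g (φ y) := by
    intro f hf y
    obtain ⟨A, hA, hy⟩ := Q₂.occurs y
    obtain ⟨g, hg, h⟩ := hf A hA
    exact ⟨g, hg, h y hy⟩
  have hF : ∀ f ∈ bitAssignments tag b M Q₂ φ, ∀ c, ∀ y ∈ B c.1,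
      (c.2.2 + (B c.1 ∩ (range c.1).biUnion B).sup fun y => b c.2.1 (φ y)) < b c.2.1 (φ y) →
      F f c = bit (f y) c.2.1
        (c.2.2 + (B c.1 ∩ (range c.1).biUnion B).sup fun y => b c.2.1 (φ y)) := by
    intro f hf c y hy hlt
    rw [Bool.eq_iff_iff]
    simp only [F, decide_eq_true_eq]
    refine ⟨fun ⟨y', hy', hbit⟩ => ?_, fun h => ⟨y, hy, h⟩⟩
    obtain ⟨g, -, hg⟩ := hform f hf y'
    rw [← hbit]
    refine bitAssignments_agree hM hf (hclique _ c.1.2) hy hy' hlt ?_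
    rw [hg] at hbit
    exact lt_of_bit_dotTuple hbit
  have hinj : Set.InjOn F (bitAssignments tag b M Q₂ φ) := by
    intro f hf f' hf' hff
    have main : ∀ i < m, ∀ y ∈ B i, f y = f' y := by
      intro i
      induction i using Nat.strong_induction_on with
      | _ i ih =>
        intro hi y hy
        obtain ⟨g, hg, h⟩ := hform f hf y
        obtain ⟨g', hg', h'⟩ := hform f' hf' y
        rw [h, h']
        refine dotTuple_eq_of_bit_eq hM hg hg' fun k j hj => ?_
        rw [← h, ← h']
        -- A bit visible on the separator is already known from an earlier bag; any other bit is in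
        -- the code.
        by_cases hlt : j < (B i ∩ (range i).biUnion B).sup fun y => b k (φ y)
        · obtain ⟨s, hs, hsj⟩ := Finset.lt_sup_iff.1 hlt
          obtain ⟨hsB, hsU⟩ := mem_inter.1 hs
          obtain ⟨i', hi', hsi'⟩ := mem_biUnion.1 hsU
          have hi' := mem_range.1 hi'
          rw [bitAssignments_agree hM hf (hclique i hi) hy hsB hj hsj,
            bitAssignments_agree hM hf' (hclique i hi) hy hsB hj hsj,
            ih i' hi' (hi'.trans hi) s hsi']
        · have hjB : j < (B i).sup fun y => b k (φ y) := Finset.lt_sup_iff.2 ⟨y, hy, hj⟩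
          obtain ⟨j', rfl⟩ := Nat.exists_eq_add_of_le' (not_lt.1 hlt)
          have h1 := hF f hf ⟨⟨i, hi⟩, k, ⟨j', by dsimp only; omega⟩⟩ y hy hj
          have h2 := hF f' hf' ⟨⟨i, hi⟩, k, ⟨j', by dsimp only; omega⟩⟩ y hy hj
          rw [← hff] at h2
          exact h1.symm.trans h2
    funext y
    obtain ⟨i, hi, hy⟩ := hcover y
    exact main i hi y hy
  rw [← hinj.ncard_image]
  refine (Set.ncard_le_ncard (Set.subset_univ _) (Set.toFinite _)).trans ?_
  rw [Set.ncard_univ, Nat.card_eq_fintype_card]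
  simp

theorem isWitness_bitRelation {K : Type} [Fintype K] {tag : V₁ → K} {b : K → V₁ → ℕ} [Fintype V₁]
    [Fintype V₂] [DecidableEq V₂] (htag : Function.Injective tag) (hM : ∀ k x, b k x ≤ M)
    (B : ℕ → Finset V₂) (m : ℕ) (hclique : ∀ i < m, Q₂.gaifman.IsClique (B i : Set V₂))
    (hcover : ∀ y, ∃ i < m, y ∈ B i) (c : ℕ) (hc : Nat.card (V₂ → V₁) < 2 ^ c)
    (hlt : ∀ φ, Q₂.IsHom Q₁ φ → c + ∑ i : Fin m, ∑ k, ((B i).sup (fun y => b k (φ y)) -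
      (B i ∩ (range i).biUnion B).sup fun y => b k (φ y)) ≤ ∑ k, univ.sup (b k)) :
    IsWitness Q₁ Q₂ (bitRelation tag b M) := by
  classical
  refine lt_of_lt_of_le ?_ (two_pow_le_ncard_bitRelation hM)
  set H := ∑ k, univ.sup (b k) with hH
  have hsub : Q₂.hom (Q₁.induced (bitRelation tag b M)) ⊆
      ⋃ φ ∈ ({φ | Q₂.IsHom Q₁ φ} : Finset (V₂ → V₁)), bitAssignments tag b M Q₂ φ := by
    intro f hf
    obtain ⟨φ, hφ, hfφ⟩ := exists_mem_bitAssignments htag hf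
    exact Set.mem_iUnion₂.2 ⟨φ, by simpa using hφ, hfφ⟩
  have hle : (Q₂.hom (Q₁.induced (bitRelation tag b M))).ncard ≤
      ∑ φ with Q₂.IsHom Q₁ φ, (bitAssignments tag b M Q₂ φ).ncard :=
    (Set.ncard_le_ncard hsub (Set.toFinite _)).trans (Finset.set_ncard_biUnion_le _ _)
  refine hle.trans_lt ?_
  by_cases hcH : c ≤ H
  · calc _ ≤ ∑ φ : V₂ → V₁ with Q₂.IsHom Q₁ φ, 2 ^ (H - c) := by
            refine sum_le_sum fun φ hφ => (ncard_bitAssignments_le hM φ B m hclique hcover).trans ?_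
            have := hlt φ (mem_filter.1 hφ).2
            exact Nat.pow_le_pow_right two_pos (by omega)
      _ ≤ Nat.card (V₂ → V₁) * 2 ^ (H - c) := by
            rw [sum_const, smul_eq_mul, Nat.card_eq_fintype_card]
            exact Nat.mul_le_mul_right _ (card_le_univ _)
      _ < 2 ^ c * 2 ^ (H - c) := by gcongr
      _ = 2 ^ H := by rw [← pow_add, Nat.add_sub_cancel' hcH]
  -- If `c` exceeds the total, `hlt` leaves no `φ`, hence no homomorphism to the induced database.
  · have : ({φ | Q₂.IsHom Q₁ φ} : Finset (V₂ → V₁)) = ∅ :=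
      filter_eq_empty_iff.2 fun φ _ hφ => hcH (le_trans (Nat.le_add_right _ _) (hlt φ hφ))
    rw [this, sum_empty]
    positivity

end BitRelation

/-! ### Rounding to integers -/

theorem sup_floor_mul {α : Type*} (X : Finset α) (a : α → ℝ≥0) (N : ℕ) :
    X.sup (fun x => ⌊(N : ℝ≥0) * a x⌋₊) = ⌊(N : ℝ≥0) * X.sup a⌋₊ :=
  (apply_sup_eq_sup_comp_of_linearOrder (fun t : ℝ≥0 => ⌊(N : ℝ≥0) * t⌋₊)
    (fun _ _ h => Nat.floor_mono (mul_le_mul_right h _)) (by simp)).symm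

/-- Scaling and rounding a sum of maximum functions to natural numbers. -/
theorem exists_nat_sup_le {K α : Type*} [Fintype K] [Fintype α] (a : K → α → ℝ≥0) (m c : ℕ)
    {δ : ℝ} (hδ : 0 < δ) :
    ∃ b : K → α → ℕ, (∀ k x, a k x = 0 → b k x = 0) ∧
      ∀ X S : ℕ → Finset α, (∀ i, S i ⊆ X i) →
        ∑ i ∈ range m, ∑ k, (((X i).sup (a k) : ℝ≥0) - ((S i).sup (a k) : ℝ≥0) : ℝ) + δ ≤
          ∑ k, ((univ.sup (a k) : ℝ≥0) : ℝ) →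
        c + ∑ i ∈ range m, ∑ k, ((X i).sup (b k) - (S i).sup (b k)) ≤ ∑ k, univ.sup (b k) := by
  -- The scaled gap `N * δ` must cover `c`, an error of 1 for each of the `m * card K` differences,
  -- and 1 for each of the `card K` terms on the right.
  obtain ⟨N, hN⟩ := exists_nat_ge ((c + (m + 1) * Fintype.card K) / δ)
  rw [div_le_iff₀ hδ] at hN
  refine ⟨fun k x => ⌊(N : ℝ≥0) * a k x⌋₊, fun k x h => by simp [h], fun X S hSX h => ?_⟩
  have hle : ∀ (Y : Finset α) k, ((Y.sup fun x => ⌊(N : ℝ≥0) * a k x⌋₊ : ℕ) : ℝ) ≤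
      N * (Y.sup (a k) : ℝ≥0) := fun Y k => by
    rw [sup_floor_mul]
    exact_mod_cast Nat.floor_le (zero_le (a := (N : ℝ≥0) * Y.sup (a k)))
  have hge : ∀ (Y : Finset α) k, (N * (Y.sup (a k) : ℝ≥0) : ℝ) - 1 ≤
      ((Y.sup fun x => ⌊(N : ℝ≥0) * a k x⌋₊ : ℕ) : ℝ) := fun Y k => by
    rw [sup_floor_mul, sub_le_iff_le_add]
    exact_mod_cast (Nat.lt_floor_add_one ((N : ℝ≥0) * Y.sup (a k))).le
  have h1 : ∑ i ∈ range m, ∑ k, ((((X i).sup fun x => ⌊(N : ℝ≥0) * a k x⌋₊) -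
      (S i).sup fun x => ⌊(N : ℝ≥0) * a k x⌋₊ : ℕ) : ℝ) ≤
      N * ∑ i ∈ range m, ∑ k, (((X i).sup (a k) : ℝ≥0) - ((S i).sup (a k) : ℝ≥0) : ℝ) +
        m * Fintype.card K := by
    calc _ ≤ ∑ i ∈ range m, ∑ k,
          (N * (((X i).sup (a k) : ℝ≥0) - ((S i).sup (a k) : ℝ≥0) : ℝ) + 1) := by
            gcongr with i _ k _
            rw [Nat.cast_sub (sup_mono (hSX i))]
            linarith [hle (X i) k, hge (S i) k]
      _ = _ := by simp only [sum_add_distrib, ← mul_sum, sum_const, card_range, card_univ,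
            nsmul_eq_mul, mul_one]
  have h2 : (N : ℝ) * ∑ k, ((univ.sup (a k) : ℝ≥0) : ℝ) - Fintype.card K ≤
      ∑ k, ((univ.sup fun x => ⌊(N : ℝ≥0) * a k x⌋₊ : ℕ) : ℝ) := by
    calc _ = ∑ k, ((N * (univ.sup (a k) : ℝ≥0) : ℝ) - 1) := by simp [mul_sum]
      _ ≤ _ := sum_le_sum fun k _ => hge univ k
  have h3 := mul_le_mul_of_nonneg_left h (Nat.cast_nonneg (α := ℝ) N)
  have : (c : ℝ) + ∑ i ∈ range m, ∑ k, ((((X i).sup fun x => ⌊(N : ℝ≥0) * a k x⌋₊) -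
      (S i).sup fun x => ⌊(N : ℝ≥0) * a k x⌋₊ : ℕ) : ℝ) ≤
      ∑ k, ((univ.sup fun x => ⌊(N : ℝ≥0) * a k x⌋₊ : ℕ) : ℝ) := by
    linarith
  exact_mod_cast this

/-! ### From a counterexample to a witness -/

section Main

variable {σ : Vocabulary} {V₁ V₂ : Type*} {Q₁ : Query σ V₁} {Q₂ : Query σ V₂}

theorem subset_hom_induced {D : Type} [Finite D] (P : Set (V₁ → D)) :
    P ⊆ Q₁.hom (Q₁.induced P) := fun p hp A hA =>
  Set.mem_iUnion₂.2 ⟨A.vars, hA, p, hp, rfl⟩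

theorem IsWitness.not_contained [Finite V₁] {D : Type} [Finite D] {P : Set (V₁ → D)}
    (h : IsWitness Q₁ Q₂ P) : ¬ Q₁.Contained Q₂ := fun hc => by
  have : Finite (V₁ → (Q₁.induced P).Dom) := inferInstanceAs (Finite (V₁ → D))
  have h1 : P.ncard ≤ (Q₁.hom (Q₁.induced P)).ncard :=
    Set.ncard_le_ncard (subset_hom_induced P) (Set.toFinite _)
  exact absurd (h1.trans (hc _)) (not_le.2 h)

/-- If `Q₁` is not contained in `Q₂`, then some polymatroid violates the information inequality
that is associated with a sequence of bags of `Q₂`. -/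
theorem exists_polymatroid_of_not_contained [Fintype V₁] [Fintype V₂] [DecidableEq V₁]
    [DecidableEq V₂] (hnot : ¬ Q₁.Contained Q₂) (B : ℕ → Finset V₂) (m : ℕ)
    (hcover : ∀ A ∈ Q₂.atoms, ∃ i < m, Set.range A.vars ⊆ B i)
    (hS : ∀ i < m, #(B i ∩ (range i).biUnion B) ≤ 1) :
    ∃ h : Finset V₁ → ℝ, h ∅ = 0 ∧ (∀ Z X Y, h (Z ∪ X ∪ Y) + h Z ≤ h (Z ∪ X) + h (Z ∪ Y)) ∧
      ∃ δ > 0, ∀ φ, Q₂.IsHom Q₁ φ → ∑ i ∈ range m, (h ((B i).image φ) -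
        h ((B i ∩ (range i).biUnion B).image φ)) + δ ≤ h univ := by
  classical
  simp only [Query.Contained, not_forall, not_le] at hnot
  obtain ⟨𝒟, hlt⟩ := hnot
  have := Fintype.ofFinite 𝒟.Dom
  let P : Finset (V₁ → 𝒟.Dom) := (Q₁.hom 𝒟).toFinite.toFinset
  have hPmem : ∀ p, p ∈ P ↔ p ∈ Q₁.hom 𝒟 := fun p => Set.Finite.mem_toFinset _
  have hPcard : #P = (Q₁.hom 𝒟).ncard := (Set.ncard_eq_toFinset_card _ _).symm
  have hP : P.Nonempty := card_pos.1 (by omega)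
  have hbound : ∀ φ, Q₂.IsHom Q₁ φ → 0 < (Q₂.hom 𝒟).ncard ∧
      ∑ i ∈ range m, (entropy P ((B i).image φ) -
        entropy P ((B i ∩ (range i).biUnion B).image φ)) ≤ Real.log (Q₂.hom 𝒟).ncard := by
    intro φ hφ
    let F : Finset (V₂ → 𝒟.Dom) := {f | ∀ i < m, ∃ p ∈ P, ∀ y ∈ B i, f y = p (φ y)}
    have hF0 : 0 < #F := by
      obtain ⟨p, hp⟩ := hP
      exact card_pos.2 ⟨p ∘ φ, mem_filter.2 ⟨mem_univ _, fun i _ => ⟨p, hp, fun _ _ => rfl⟩⟩⟩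
    have hF : #F ≤ (Q₂.hom 𝒟).ncard := by
      rw [← Set.ncard_coe_finset]
      refine Set.ncard_le_ncard (fun f hf A hA => ?_) (Set.toFinite _)
      obtain ⟨i, hi, hAi⟩ := hcover A hA
      obtain ⟨p, hp, hpf⟩ := (mem_filter.1 hf).2 i hi
      have h1 : f ∘ A.vars = p ∘ φ ∘ A.vars := funext fun j => hpf _ (hAi ⟨j, rfl⟩)
      rw [h1]
      exact (hPmem p).1 hp _ (hφ A hA)
    exact ⟨by omega, (sum_entropy_le_log_card hP m hS).trans
      (Real.log_le_log (by exact_mod_cast hF0) (by exact_mod_cast hF))⟩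
  refine ⟨entropy P, entropy_empty hP, entropy_submodular P, ?_⟩
  rw [entropy_univ, hPcard]
  -- If `Q₂` has no homomorphism to `𝒟`, there is no `φ` either, since composing it with a tuple of
  -- `P` would give one. Any `δ` then works.
  rcases Nat.eq_zero_or_pos (Q₂.hom 𝒟).ncard with h0 | h0
  · exact ⟨1, one_pos, fun φ hφ => absurd h0 (hbound φ hφ).1.ne'⟩
  · refine ⟨Real.log (Q₁.hom 𝒟).ncard - Real.log (Q₂.hom 𝒟).ncard,
      sub_pos.2 (Real.log_lt_log (by exact_mod_cast h0) (by exact_mod_cast hlt)), fun φ hφ => ?_⟩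
    linarith [(hbound φ hφ).2]

theorem exists_isWitness_bitRelation [Fintype V₁] [Fintype V₂] [DecidableEq V₁] [DecidableEq V₂]
    (B : ℕ → Finset V₂) (m : ℕ) (hclique : ∀ i < m, Q₂.gaifman.IsClique (B i : Set V₂))
    (hcover : ∀ A ∈ Q₂.atoms, ∃ i < m, Set.range A.vars ⊆ B i)
    (a : V₁ → V₁ → ℝ≥0) {δ : ℝ} (hδ : 0 < δ)
    (ha : ∀ φ, Q₂.IsHom Q₁ φ →
      ∑ i ∈ range m, (∑ k, ((((B i).image φ).sup (a k) : ℝ≥0) : ℝ) -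
        ∑ k, ((((B i ∩ (range i).biUnion B).image φ).sup (a k) : ℝ≥0) : ℝ)) + δ ≤
          ∑ k, ((univ.sup (a k) : ℝ≥0) : ℝ)) :
    ∃ (n : ℕ) (e : V₁ ≃ Fin n) (b : Fin n → V₁ → ℕ) (M : ℕ),
      (∀ k x, a (e.symm k) x = 0 → b k x = 0) ∧ IsWitness Q₁ Q₂ (bitRelation e b M) := by
  -- Rows are indexed by `Fin n` because witness domains live in `Type`, whereas `V₁` may lie in any
  -- universe.
  let e := Fintype.equivFin V₁
  obtain ⟨c, hc⟩ : ∃ c, Nat.card (V₂ → V₁) < 2 ^ c := ⟨_, Nat.lt_two_pow_self⟩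
  obtain ⟨b, hb0, hb⟩ := exists_nat_sup_le (fun k => a (e.symm k)) m c hδ
  have hsum : ∀ F : (V₁ → ℝ≥0) → ℝ, ∑ k, F (a (e.symm k)) = ∑ k, F (a k) := fun F =>
    Equiv.sum_comp e.symm fun k => F (a k)
  refine ⟨_, e, b, univ.sup fun k => univ.sup (b k), hb0, isWitness_bitRelation e.injective
    (fun k x => (le_sup (f := b k) (mem_univ x)).trans
      (le_sup (f := fun k => univ.sup (b k)) (mem_univ k))) B m hclique (fun y => ?_) c hc
    fun φ hφ => ?_⟩
  · obtain ⟨A, hA, hy⟩ := Q₂.occurs y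
    obtain ⟨i, hi, hAi⟩ := hcover A hA
    exact ⟨i, hi, hAi hy⟩
  · have := hb (fun i => (B i).image φ) (fun i => (B i ∩ (range i).biUnion B).image φ)
      (fun i => image_subset_image inter_subset_left) (by
        simp only [sum_sub_distrib]
        simp only [hsum fun c => ((univ.sup c : ℝ≥0) : ℝ), fun X : Finset V₁ =>
          hsum fun c => ((X.sup c : ℝ≥0) : ℝ)]
        simpa only [sum_sub_distrib] using ha φ hφ)
    simp only [sup_image] at this
    rw [Fin.sum_univ_eq_sum_range (fun i => ∑ k, ((B i).sup (fun y => b k (φ y)) -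
      (B i ∩ (range i).biUnion B).sup fun y => b k (φ y))) m]
    exact this

/-- Passing from `h` to the sum of maxima does not raise the bag terms, fixes the separator terms,
whose arguments have at most one element, and does not lower the total. -/
theorem hasNormalWitness_of_not_contained [Fintype V₁] [Fintype V₂] [DecidableEq V₂]
    (hnot : ¬ Q₁.Contained Q₂) (B : ℕ → Finset V₂) (m : ℕ)
    (hclique : ∀ i < m, Q₂.gaifman.IsClique (B i : Set V₂))
    (hcover : ∀ A ∈ Q₂.atoms, ∃ i < m, Set.range A.vars ⊆ B i)
    (hS : ∀ i < m, #(B i ∩ (range i).biUnion B) ≤ 1) : HasNormalWitness Q₁ Q₂ := by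
  classical
  obtain ⟨h, h0, hsub, δ, hδ, hh⟩ := exists_polymatroid_of_not_contained hnot B m hcover hS
  obtain ⟨a, ha1, ha2, ha3⟩ := exists_sum_sup_le hsub h0
  obtain ⟨n, e, b, M, -, hw⟩ := exists_isWitness_bitRelation (Q₁ := Q₁) B m hclique hcover a hδ
    fun φ hφ => by
      have hun : h univ ≤ ∑ k, ((univ.sup (a k) : ℝ≥0) : ℝ) := by
        rw [← ha2]
        exact sum_le_sum fun k _ => NNReal.coe_le_coe.2 (le_sup (mem_univ k))
      refine le_trans (add_le_add_left (sum_le_sum fun i hi => sub_le_sub (ha1 _) ?_) δ)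
        ((hh φ hφ).trans hun)
      rcases Nat.le_one_iff_eq_zero_or_eq_one.1 (hS i (mem_range.1 hi)) with h' | h'
      · rw [card_eq_zero.1 h']
        simp [h0]
      · obtain ⟨s, hs⟩ := card_eq_one.1 h'
        rw [hs]
        simp [ha3]
  exact ⟨_, _, inferInstance, inferInstance, bitCoords e b M, bitBase _ M, ⟨_, rfl⟩, hw⟩

/-- Here the separator terms all vanish, so agreement on singletons is not needed and the diagonal
rows suffice; they make each bit visible to at most one variable. -/
theorem hasProductWitness_of_not_contained [Fintype V₁] [Fintype V₂] [DecidableEq V₂]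
    (hnot : ¬ Q₁.Contained Q₂) (B : ℕ → Finset V₂) (m : ℕ)
    (hclique : ∀ i < m, Q₂.gaifman.IsClique (B i : Set V₂))
    (hcover : ∀ A ∈ Q₂.atoms, ∃ i < m, Set.range A.vars ⊆ B i)
    (hS : ∀ i < m, B i ∩ (range i).biUnion B = ∅) : HasProductWitness Q₁ Q₂ := by
  classical
  obtain ⟨h, h0, hsub, δ, hδ, hh⟩ := exists_polymatroid_of_not_contained hnot B m hcover
    fun i hi => by simp [hS i hi]
  obtain ⟨a, ha0, ha1, ha2⟩ := exists_modular_le hsub h0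
  obtain ⟨n, e, b, M, hb, hw⟩ := exists_isWitness_bitRelation (Q₁ := Q₁) B m hclique hcover a hδ
    fun φ hφ => by
      have hun : h univ ≤ ∑ k, ((univ.sup (a k) : ℝ≥0) : ℝ) := by
        rw [← ha2]
        exact sum_le_sum fun k _ => NNReal.coe_le_coe.2 (le_sup (mem_univ k))
      refine le_trans (add_le_add_left (sum_le_sum fun i hi => sub_le_sub (ha1 _) ?_) δ)
        ((hh φ hφ).trans hun)
      rw [hS i (mem_range.1 hi)]
      simp [h0]
  refine ⟨_, inferInstance, bitRelation e b M, isProductRelation_bitRelation e.injective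
    (fun k x hk => hb k x (ha0 _ _ fun h => hk ?_)), hw⟩
  rw [h, e.apply_symm_apply]

theorem Query.TreeDecomposition.exists_bag_enumeration [Fintype V₂] [DecidableEq V₂]
    (τ : Q₂.TreeDecomposition) : ∃ (B : ℕ → Finset V₂) (m : ℕ),
      (∀ i < m, ∃ t, (B i : Set V₂) = τ.χ t) ∧
      (∀ A ∈ Q₂.atoms, ∃ i < m, Set.range A.vars ⊆ B i) ∧
      ∀ i < m, B i ∩ (range i).biUnion B = ∅ ∨
        ∃ t u, τ.T.Adj t u ∧ ((B i ∩ (range i).biUnion B : Finset V₂) : Set V₂) ⊆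
          τ.χ t ∩ τ.χ u := by
  classical
  have := τ.finiteNode
  have := Fintype.ofFinite τ.Node
  have hχ : ∀ t, (((τ.χ t).toFinset : Finset V₂) : Set V₂) = τ.χ t := fun t => by simp
  obtain ⟨B, h1, h2, h3⟩ := τ.acyclic.exists_bag_enumeration (fun t => (τ.χ t).toFinset) univ
    fun x => by simpa using (τ.running x).edgeConnectedOn
  refine ⟨B, #(univ : Finset τ.Node), fun i hi => ?_, fun A hA => ?_, fun i hi => ?_⟩
  · obtain ⟨t, -, ht⟩ := h1 i hi
    exact ⟨t, by rw [ht, hχ]⟩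
  · obtain ⟨t, ht⟩ := τ.coverage A hA
    obtain ⟨i, hi, hit⟩ := h2 t (mem_univ t)
    exact ⟨i, hi, by rw [hit, hχ]; exact ht⟩
  · refine (h3 i hi).imp_right fun ⟨t, u, htu, hsub⟩ => ⟨t, u, htu, ?_⟩
    rw [← hχ t, ← hχ u, ← coe_inter]
    exact_mod_cast hsub

end Main

end CQ

theorem theorem3p3 {σ : CQ.Vocabulary} {V₁ V₂ : Type*} [Finite V₁] [Finite V₂]
    (Q₁ : CQ.Query σ V₁) (Q₂ : CQ.Query σ V₂) (hQ₂ : Q₂.IsChordal) :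
    ((∃ τ : Q₂.TreeDecomposition, τ.IsJunctionTree ∧ τ.IsTotallyDisconnected) →
      (¬ Q₁.Contained Q₂ ↔ CQ.HasProductWitness Q₁ Q₂)) ∧
    ((∃ τ : Q₂.TreeDecomposition, τ.IsJunctionTree ∧ τ.IsSimple) →
      (¬ Q₁.Contained Q₂ ↔ CQ.HasNormalWitness Q₁ Q₂)) := by
  classical
  have := Fintype.ofFinite V₁
  have := Fintype.ofFinite V₂
  refine ⟨fun ⟨τ, hτ, hdisc⟩ => ⟨fun hnot => ?_, fun ⟨_, _, _, _, h⟩ => h.not_contained⟩,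
    fun ⟨τ, hτ, hsimple⟩ => ⟨fun hnot => ?_, fun ⟨_, _, _, _, _, _, _, h⟩ => h.not_contained⟩⟩ <;>
    obtain ⟨B, m, hB, hcover, hS⟩ := τ.exists_bag_enumeration
  · refine CQ.hasProductWitness_of_not_contained hnot B m (fun i hi => ?_) hcover fun i hi => ?_
    · obtain ⟨t, ht⟩ := hB i hi
      exact ht ▸ (hτ t).prop
    · refine (hS i hi).elim id fun ⟨t, u, htu, hsub⟩ => ?_
      rw [hdisc t u htu] at hsub
      exact_mod_cast Set.subset_empty_iff.1 hsub
  · refine CQ.hasNormalWitness_of_not_contained hnot B m (fun i hi => ?_) hcover fun i hi => ?_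
    · obtain ⟨t, ht⟩ := hB i hi
      exact ht ▸ (hτ t).prop
    · rcases hS i hi with h | ⟨t, u, htu, hsub⟩
      · simp [h]
      · have := (Set.encard_le_encard hsub).trans (hsimple t u htu)
        rw [Set.encard_coe_eq_coe_finsetCard] at this
        exact_mod_cast this
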